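/- For a finite group $G$ let $L(G)$ be the set of subgroups of $G$ and $L_1(G)$ the set of cyclic subgroups of $G$, and for $H\in L(G)$ define the relative cyclic subgroup commutativity degree $$csd(H,G)=\frac{|\{(H_1,G_1)\in L_1(H)\times L_1(G) : H_1G_1=G_1H_1\}|}{|L_1(H)|\,|L_1(G)|}.$$ Let $f_1:L(G)\to[0,1]$ be given by $f_1(H)=csd(H,G)$, so that $|\mathrm{Im}\, f_1|$ is the number of relative cyclic subgroup commutativity degrees of $G$. Let $G$ be a finite group isomorphic to one of the following groups of order $2^n$: - the dihedral group $D_{2^n}=\langle x,y \mid x^{2^{n-1}}=y^2=1,\ yxy=x^{-1}\rangle$ with $n\ge 3$; - the generalized quaternion group $Q_{2^n}=\langle x,y \mid x^{2^{n-1}}=1,\ y^2=x^{2^{n-2}},\ yxy^{-1}=x^{-1}\rangle$ with $n\ge 3$; - the quasidihedral group $S_{2^n}=\langle x,y \mid x^{2^{n-1}}=y^2=1,\ y^{-1}xy=x^{2^{n-2}-1}\rangle$ with $n\ge 4$. Then $|\mathrm{Im}\, f_1|\neq 2$. -/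

import Mathlib

open scoped Pointwise

/-- `L₁(H)`: the set of cyclic subgroups of `H`, regarded as subgroups of the ambient group `G`
that are contained in `H`. In particular `cyclicSubgroups ⊤` is `L₁(G)`. -/
def cyclicSubgroups {G : Type*} [Group G] (H : Subgroup G) : Set (Subgroup G) :=
  {C | C ≤ H ∧ IsCyclic C}

/-- The relative cyclic subgroup commutativity degree `csd(H, G)` of a subgroup `H` of a finite
group `G`: the proportion of the pairs `(H₁, G₁) ∈ L₁(H) × L₁(G)` with `H₁G₁ = G₁H₁`
(equality of product sets). -/
noncomputable def relCsd {G : Type*} [Group G] (H : Subgroup G) : ℚ :=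
  ({p : Subgroup G × Subgroup G | p.1 ∈ cyclicSubgroups H ∧ p.2 ∈ cyclicSubgroups (⊤ : Subgroup G) ∧
      (p.1 : Set G) * (p.2 : Set G) = (p.2 : Set G) * (p.1 : Set G)}.ncard : ℚ) /
    (((cyclicSubgroups H).ncard : ℚ) * ((cyclicSubgroups (⊤ : Subgroup G)).ncard : ℚ))

/-- The number of relative cyclic subgroup commutativity degrees of `G`: the number of values
of `H ↦ csd(H, G)` on the subgroups `H` of `G`. -/
noncomputable def numRelCsd (G : Type*) [Group G] : ℕ :=
  (Set.range (fun H : Subgroup G => relCsd H)).ncard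

/-- The defining relators of the quasidihedral group of order `2 ^ n` on the generators
`x = of 0` and `y = of 1`: `x ^ (2 ^ (n - 1)) = y ^ 2 = 1` and `y⁻¹ x y = x ^ (2 ^ (n - 2) - 1)`.
Used for `n ≥ 4`, where the truncated subtractions are the usual ones. -/
def quasidihedralRels (n : ℕ) : Set (FreeGroup (Fin 2)) :=
  {FreeGroup.of 0 ^ (2 ^ (n - 1)),
   FreeGroup.of 1 ^ 2,
   (FreeGroup.of 1)⁻¹ * FreeGroup.of 0 * FreeGroup.of 1 *
     (FreeGroup.of 0 ^ (2 ^ (n - 2) - 1))⁻¹}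

/-- The quasidihedral group `S_{2^n}` of order `2 ^ n`, by its standard presentation. -/
abbrev QuasidihedralGroup (n : ℕ) : Type :=
  PresentedGroup (quasidihedralRels n)

section Counting

variable {G : Type*} [Group G]

theorem mem_cyclicSubgroups_iff {H C : Subgroup G} :
    C ∈ cyclicSubgroups H ↔ ∃ g ∈ H, Subgroup.zpowers g = C := by
  constructor
  · rintro ⟨hle, hc⟩
    obtain ⟨g, hg⟩ := (Subgroup.isCyclic_iff_exists_zpowers_eq_top C).1 hc
    exact ⟨g, hle (hg ▸ Subgroup.mem_zpowers g), hg⟩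
  · rintro ⟨g, hg, rfl⟩
    exact ⟨by simpa using hg, inferInstance⟩

variable [Finite G]

/-- The finite set of cyclic subgroups contained in `H`. -/
noncomputable def cyclicFinset (H : Subgroup G) : Finset (Subgroup G) :=
  (Set.toFinite (cyclicSubgroups H)).toFinset

theorem mem_cyclicFinset_iff {H C : Subgroup G} :
    C ∈ cyclicFinset H ↔ ∃ g ∈ H, Subgroup.zpowers g = C := by
  rw [cyclicFinset, Set.Finite.mem_toFinset, mem_cyclicSubgroups_iff]

theorem cyclicFinset_nonempty (H : Subgroup G) : (cyclicFinset H).Nonempty :=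
  ⟨Subgroup.zpowers 1, mem_cyclicFinset_iff.2 ⟨1, H.one_mem, rfl⟩⟩

/-- The number of cyclic subgroups of `G` that do not permute with `C`. -/
noncomputable def permDefect (C : Subgroup G) : ℕ :=
  open Classical in
  ((cyclicFinset (⊤ : Subgroup G)).filter
    fun K : Subgroup G => ¬ (C : Set G) * (K : Set G) = (K : Set G) * (C : Set G)).card

theorem permDefect_eq_zero_of_normal (C : Subgroup G) [C.Normal] : permDefect C = 0 := by
  classical
  rw [permDefect, Finset.card_eq_zero, Finset.filter_eq_empty_iff]
  intro K _ h
  exact h (by rw [← Subgroup.normal_mul, ← Subgroup.mul_normal, sup_comm])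

theorem one_sub_relCsd (H : Subgroup G) :
    1 - relCsd H = (∑ C ∈ cyclicFinset H, (permDefect C : ℚ)) /
      (((cyclicFinset H).card : ℚ) * ((cyclicFinset (⊤ : Subgroup G)).card : ℚ)) := by
  classical
  have hc (K : Subgroup G) : (cyclicSubgroups K).ncard = (cyclicFinset K).card :=
    Set.ncard_eq_toFinset_card _ _
  have hp : ({p : Subgroup G × Subgroup G | p.1 ∈ cyclicSubgroups H ∧
      p.2 ∈ cyclicSubgroups (⊤ : Subgroup G) ∧
      (p.1 : Set G) * (p.2 : Set G) = (p.2 : Set G) * (p.1 : Set G)}.ncard) =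
      ∑ C ∈ cyclicFinset H, ((cyclicFinset (⊤ : Subgroup G)).filter
        fun K : Subgroup G => (C : Set G) * (K : Set G) = (K : Set G) * (C : Set G)).card := by
    rw [← Finset.card_sigma, ← Set.ncard_coe_finset]
    refine Set.ncard_congr (fun p _ => ⟨p.1, p.2⟩) ?_ ?_ ?_
    · rintro ⟨a, b⟩ ⟨h1, h2, h3⟩
      simp [cyclicFinset, h1, h2, h3]
    · rintro ⟨a, b⟩ ⟨c, d⟩ _ _ h
      simpa using h
    · rintro ⟨a, b⟩ h
      simp only [Finset.coe_sigma, Set.mem_sigma_iff, Finset.mem_coe, Finset.mem_filter,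
        cyclicFinset, Set.Finite.mem_toFinset] at h
      exact ⟨(a, b), ⟨h.1, h.2.1, h.2.2⟩, rfl⟩
  have hsum (C : Subgroup G) : (((cyclicFinset (⊤ : Subgroup G)).filter
        fun K : Subgroup G => (C : Set G) * (K : Set G) = (K : Set G) * (C : Set G)).card : ℚ) =
      (cyclicFinset (⊤ : Subgroup G)).card - permDefect C := by
    rw [eq_sub_iff_add_eq, permDefect]
    exact_mod_cast Finset.card_filter_add_card_filter_not _
  have h1 : ((cyclicFinset H).card : ℚ) ≠ 0 := by
    exact_mod_cast (cyclicFinset_nonempty H).card_ne_zero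
  have h2 : ((cyclicFinset (⊤ : Subgroup G)).card : ℚ) ≠ 0 := by
    exact_mod_cast (cyclicFinset_nonempty _).card_ne_zero
  rw [relCsd, hp, hc, hc]
  push_cast
  simp only [hsum, Finset.sum_sub_distrib, Finset.sum_const, nsmul_eq_mul]
  field_simp
  ring

theorem relCsd_eq_one_iff (H : Subgroup G) :
    relCsd H = 1 ↔ ∑ C ∈ cyclicFinset H, (permDefect C : ℚ) = 0 := by
  have h1 : ((cyclicFinset H).card : ℚ) ≠ 0 := by
    exact_mod_cast (cyclicFinset_nonempty H).card_ne_zero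
  have h2 : ((cyclicFinset (⊤ : Subgroup G)).card : ℚ) ≠ 0 := by
    exact_mod_cast (cyclicFinset_nonempty _).card_ne_zero
  rw [eq_comm, ← sub_eq_zero, one_sub_relCsd, div_eq_zero_iff]
  simp [h1, h2]

theorem relCsd_bot : relCsd (⊥ : Subgroup G) = 1 := by
  rw [relCsd_eq_one_iff]
  refine Finset.sum_eq_zero fun C hC => ?_
  obtain ⟨g, hg, rfl⟩ := mem_cyclicFinset_iff.1 hC
  rw [Subgroup.mem_bot.1 hg, Subgroup.zpowers_one_eq_bot, permDefect_eq_zero_of_normal]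
  rfl

/-- If there are exactly two degrees, then the average defect is the same over all subgroups on
which the total defect does not vanish. -/
theorem exists_average_of_numRelCsd_eq_two (h : numRelCsd G = 2) :
    ∃ t : ℚ, ∀ H : Subgroup G, ∑ C ∈ cyclicFinset H, (permDefect C : ℚ) ≠ 0 →
      ∑ C ∈ cyclicFinset H, (permDefect C : ℚ) = t * (cyclicFinset H).card := by
  have hv : ∃ v : ℚ, ∀ H : Subgroup G, relCsd H ≠ 1 → relCsd H = v := by
    obtain ⟨a, b, -, hab⟩ := Set.ncard_eq_two.1 h
    have hmem (H : Subgroup G) : relCsd H = a ∨ relCsd H = b := by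
      have : relCsd H ∈ Set.range (fun H : Subgroup G => relCsd H) := ⟨H, rfl⟩
      rw [hab] at this
      simpa using this
    rcases hmem ⊥ with h1 | h1 <;> rw [relCsd_bot] at h1
    · exact ⟨b, fun H hH => (hmem H).resolve_left (h1 ▸ hH)⟩
    · exact ⟨a, fun H hH => (hmem H).resolve_right (h1 ▸ hH)⟩
  obtain ⟨v, hv⟩ := hv
  refine ⟨(1 - v) * (cyclicFinset (⊤ : Subgroup G)).card, fun H hH => ?_⟩
  have h1 : ((cyclicFinset H).card : ℚ) ≠ 0 := by
    exact_mod_cast (cyclicFinset_nonempty H).card_ne_zero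
  have h2 : ((cyclicFinset (⊤ : Subgroup G)).card : ℚ) ≠ 0 := by
    exact_mod_cast (cyclicFinset_nonempty _).card_ne_zero
  rw [← hv H (fun h => hH ((relCsd_eq_one_iff H).1 h)), one_sub_relCsd]
  field_simp

theorem numRelCsd_eq_one_of_normal (h : ∀ g : G, (Subgroup.zpowers g).Normal) :
    numRelCsd G = 1 := by
  have h1 (H : Subgroup G) : relCsd H = 1 := by
    rw [relCsd_eq_one_iff]
    refine Finset.sum_eq_zero fun C hC => ?_
    obtain ⟨g, -, rfl⟩ := mem_cyclicFinset_iff.1 hC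
    have := h g
    rw [permDefect_eq_zero_of_normal]
    rfl
  simp [numRelCsd, h1]

/-- For an element `g` of order `2` or `4`, the cyclic group `⟨g⟩` has one more subgroup than it
has generators. -/
theorem card_cyclicFinset_zpowers [Fintype G] [DecidableEq (Subgroup G)] {g : G} (hg : g ≠ 1)
    (hg4 : g ^ 4 = 1) :
    (cyclicFinset (Subgroup.zpowers g)).card =
      (Finset.univ.filter fun x : G => Subgroup.zpowers x = Subgroup.zpowers g).card + 1 := by
  classical
  have hpow {x : G} (hx : x ∈ Subgroup.zpowers g) : x = 1 ∨ x = g ∨ x = g ^ 2 ∨ x = g⁻¹ := by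
    obtain ⟨k, hk, rfl⟩ := mem_zpowers_iff_mem_range_orderOf.1 hx |> Finset.mem_image.1
    have hk4 : k < 4 := (Finset.mem_range.1 hk).trans_le (orderOf_le_of_pow_eq_one (by simp) hg4)
    interval_cases k
    · simp
    · simp
    · simp
    · exact Or.inr (Or.inr (Or.inr (eq_inv_of_mul_eq_one_left (by rw [← pow_succ, hg4]))))
  have hbot : Subgroup.zpowers g ≠ ⊥ := by simpa using hg
  by_cases hg2 : g ^ 2 = 1
  · have hinv : g⁻¹ = g := (eq_inv_of_mul_eq_one_left (by rw [← pow_two, hg2])).symm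
    have e1 : cyclicFinset (Subgroup.zpowers g) = {⊥, Subgroup.zpowers g} := by
      ext C
      rw [mem_cyclicFinset_iff, Finset.mem_insert, Finset.mem_singleton]
      constructor
      · rintro ⟨x, hx, rfl⟩
        rcases hpow hx with rfl | rfl | rfl | rfl <;> simp [hg2]
      · rintro (rfl | rfl)
        · exact ⟨1, Subgroup.one_mem _, Subgroup.zpowers_one_eq_bot⟩
        · exact ⟨g, Subgroup.mem_zpowers g, rfl⟩
    have e2 : (Finset.univ.filter fun x : G => Subgroup.zpowers x = Subgroup.zpowers g) = {g} := by
      ext x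
      simp only [Finset.mem_filter, Finset.mem_univ, true_and, Finset.mem_singleton]
      constructor
      · intro hx
        rcases hpow (hx ▸ Subgroup.mem_zpowers x) with h | h | h | h
        · subst h; exact absurd (hx.symm.trans Subgroup.zpowers_one_eq_bot) hbot
        · exact h
        · rw [hg2] at h; subst h; exact absurd (hx.symm.trans Subgroup.zpowers_one_eq_bot) hbot
        · rw [h, hinv]
      · rintro rfl; rfl
    rw [e1, e2, Finset.card_pair hbot.symm, Finset.card_singleton]
  · have hne : Subgroup.zpowers (g ^ 2) ≠ Subgroup.zpowers g := by
      intro h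
      obtain ⟨k, hk⟩ := Subgroup.mem_zpowers_iff.1 (h ▸ Subgroup.mem_zpowers g)
      apply hg2
      rw [← hk, ← zpow_natCast, ← zpow_mul, mul_comm, zpow_mul, zpow_natCast, ← pow_mul, hg4,
        one_zpow]
    have e1 : cyclicFinset (Subgroup.zpowers g) =
        {⊥, Subgroup.zpowers (g ^ 2), Subgroup.zpowers g} := by
      ext C
      rw [mem_cyclicFinset_iff, Finset.mem_insert, Finset.mem_insert, Finset.mem_singleton]
      constructor
      · rintro ⟨x, hx, rfl⟩
        rcases hpow hx with rfl | rfl | rfl | rfl <;> simp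
      · rintro (rfl | rfl | rfl)
        · exact ⟨1, Subgroup.one_mem _, Subgroup.zpowers_one_eq_bot⟩
        · exact ⟨g ^ 2, Subgroup.pow_mem _ (Subgroup.mem_zpowers g) 2, rfl⟩
        · exact ⟨g, Subgroup.mem_zpowers g, rfl⟩
    have e2 : (Finset.univ.filter fun x : G => Subgroup.zpowers x = Subgroup.zpowers g) =
        {g, g⁻¹} := by
      ext x
      simp only [Finset.mem_filter, Finset.mem_univ, true_and, Finset.mem_singleton,
        Finset.mem_insert]
      constructor
      · intro hx
        rcases hpow (hx ▸ Subgroup.mem_zpowers x) with h | h | h | h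
        · subst h; exact absurd (hx.symm.trans Subgroup.zpowers_one_eq_bot) hbot
        · exact Or.inl h
        · exact absurd (h ▸ hx) hne
        · exact Or.inr h
      · rintro (rfl | rfl) <;> simp
    have hinv : g ≠ g⁻¹ := fun h => hg2 (by rw [pow_two]; exact mul_eq_one_iff_eq_inv.2 h)
    have hbot2 : (⊥ : Subgroup G) ≠ Subgroup.zpowers (g ^ 2) := by
      rw [ne_comm]
      simpa using hg2
    rw [e1, e2, Finset.card_pair hinv, Finset.card_eq_three.2
      ⟨_, _, _, hbot2, hbot.symm, hne, rfl⟩]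

/-- A group with an index two subgroup `A` all of whose cyclic subgroups are normal, and whose
elements outside `A` have order dividing `4` and generate subgroups with a nonzero defect. -/
theorem numRelCsd_ne_two_of_index_two (A : Subgroup G) (hA : A.index = 2)
    (hnormal : ∀ a ∈ A, (Subgroup.zpowers a).Normal)
    (hfour : ∀ g ∉ A, g ^ 4 = 1)
    (hdefect : ∀ g ∉ A, permDefect (Subgroup.zpowers g) ≠ 0)
    (hinv : ∃ a ∈ A, a ≠ a⁻¹) : numRelCsd G ≠ 2 := by
  classical
  have := Fintype.ofFinite G
  intro h2
  obtain ⟨t, ht⟩ := exists_average_of_numRelCsd_eq_two h2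
  have hzero {C : Subgroup G} (hC : ∃ a ∈ A, Subgroup.zpowers a = C) : permDefect C = 0 := by
    obtain ⟨a, ha, rfl⟩ := hC
    have := hnormal a ha
    exact permDefect_eq_zero_of_normal _
  have hcyc {g : G} (hg : g ∉ A) :
      ∑ C ∈ cyclicFinset (Subgroup.zpowers g), (permDefect C : ℚ) =
        permDefect (Subgroup.zpowers g) := by
    refine Finset.sum_eq_single_of_mem _
      (mem_cyclicFinset_iff.2 ⟨g, Subgroup.mem_zpowers g, rfl⟩) fun C hC hne => ?_
    obtain ⟨x, hx, rfl⟩ := mem_cyclicFinset_iff.1 hC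
    rw [hzero ⟨x, ?_, rfl⟩, Nat.cast_zero]
    obtain ⟨k, hk, rfl⟩ := mem_zpowers_iff_mem_range_orderOf.1 hx |> Finset.mem_image.1
    have hk4 : k < 4 := (Finset.mem_range.1 hk).trans_le
      (orderOf_le_of_pow_eq_one (by simp) (hfour g hg))
    interval_cases k
    · simp
    · simp at hne
    · exact Subgroup.sq_mem_of_index_two hA g
    · exfalso
      have : g ^ 3 = g⁻¹ := eq_inv_of_mul_eq_one_left (by rw [← pow_succ, hfour g hg])
      simp [this] at hne
  have hout {g : G} (hg : g ∉ A) : (permDefect (Subgroup.zpowers g) : ℚ) =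
      t * ((Finset.univ.filter fun x : G => Subgroup.zpowers x = Subgroup.zpowers g).card + 1) := by
    have h := ht (Subgroup.zpowers g)
    rw [hcyc hg, card_cyclicFinset_zpowers (by rintro rfl; exact hg A.one_mem) (hfour g hg)] at h
    exact_mod_cast h (by exact_mod_cast hdefect g hg)
  obtain ⟨y, hy⟩ : ∃ y, y ∉ A := by
    by_contra! h
    rw [(Subgroup.eq_top_iff' A).2 h, Subgroup.index_top] at hA
    omega
  have ht0 : t ≠ 0 := by
    rintro rfl
    have := hout hy
    rw [zero_mul] at this
    exact hdefect y hy (by exact_mod_cast this)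
  set B := (cyclicFinset (⊤ : Subgroup G)).filter fun C => ¬ C ≤ A with hB
  have hmemB {C : Subgroup G} : C ∈ B ↔ ∃ g ∉ A, Subgroup.zpowers g = C := by
    rw [hB, Finset.mem_filter, mem_cyclicFinset_iff]
    constructor
    · rintro ⟨⟨g, -, rfl⟩, h⟩
      exact ⟨g, by simpa using h, rfl⟩
    · rintro ⟨g, hg, rfl⟩
      exact ⟨⟨g, trivial, rfl⟩, by simpa using hg⟩
  have hsplit : (cyclicFinset (⊤ : Subgroup G)).filter (fun C => C ≤ A) = cyclicFinset A := by
    ext C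
    rw [Finset.mem_filter, mem_cyclicFinset_iff, mem_cyclicFinset_iff]
    constructor
    · rintro ⟨⟨g, -, rfl⟩, h⟩
      exact ⟨g, by simpa using h, rfl⟩
    · rintro ⟨g, hg, rfl⟩
      exact ⟨⟨g, trivial, rfl⟩, by simpa using hg⟩
  have hcard : (cyclicFinset (⊤ : Subgroup G)).card = (cyclicFinset A).card + B.card := by
    rw [← hsplit, hB, Finset.card_filter_add_card_filter_not]
  have hgens : (Finset.univ.filter fun x : G => x ∉ A).card =
      ∑ C ∈ B, (Finset.univ.filter fun x : G => Subgroup.zpowers x = C).card := by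
    rw [Finset.card_eq_sum_card_fiberwise (f := Subgroup.zpowers) (t := B)]
    · refine Finset.sum_congr rfl fun C hC => ?_
      congr 1
      ext x
      simp only [Finset.mem_filter, Finset.mem_univ, true_and, and_iff_right_iff_imp]
      rintro rfl
      simpa using (Finset.mem_filter.1 hC).2
    · intro x hx
      exact hmemB.2 ⟨x, by simpa using hx, rfl⟩
  have hsum : ∑ C ∈ cyclicFinset (⊤ : Subgroup G), (permDefect C : ℚ) =
      t * ((Finset.univ.filter fun x : G => x ∉ A).card + B.card) := by
    rw [← Finset.sum_filter_add_sum_filter_not _ (fun C => C ≤ A), hsplit,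
      Finset.sum_eq_zero (s := cyclicFinset A), zero_add, hgens, ← hB]
    · rw [Finset.card_eq_sum_ones]
      push_cast
      rw [← Finset.sum_add_distrib, Finset.mul_sum]
      refine Finset.sum_congr rfl fun C hC => ?_
      obtain ⟨g, hg, rfl⟩ := hmemB.1 hC
      exact hout hg
    · intro C hC
      rw [hzero (mem_cyclicFinset_iff.1 hC), Nat.cast_zero]
  have hBpos : 0 < B.card := Finset.card_pos.2 ⟨_, hmemB.2 ⟨y, hy, rfl⟩⟩
  have htop := ht ⊤ (by rw [hsum]; exact mul_ne_zero ht0 (by positivity))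
  rw [hsum, hcard] at htop
  have hkey : (Finset.univ.filter fun x : G => x ∉ A).card = (cyclicFinset A).card := by
    have := mul_left_cancel₀ ht0 htop
    push_cast at this
    exact_mod_cast add_right_cancel this
  have hcompl : (Finset.univ.filter fun x : G => x ∉ A).card =
      (Finset.univ.filter fun x : G => x ∈ A).card := by
    refine Finset.card_bij (fun x _ => x * y) ?_ ?_ ?_
    · intro x hx
      simp only [Finset.mem_filter, Finset.mem_univ, true_and] at hx ⊢
      simp [Subgroup.mul_mem_iff_of_index_two hA, hx, hy]
    · intro a _ b _ h
      exact mul_right_cancel h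
    · intro b hb
      simp only [Finset.mem_filter, Finset.mem_univ, true_and] at hb
      refine ⟨b * y⁻¹, ?_, by simp⟩
      simp [Subgroup.mul_mem_iff_of_index_two hA, hb, hy]
  have himage : (Finset.univ.filter fun x : G => x ∈ A).image Subgroup.zpowers =
      cyclicFinset A := by
    ext C
    simp [mem_cyclicFinset_iff]
  obtain ⟨a, ha, hne⟩ := hinv
  rw [hcompl, ← himage, eq_comm, Finset.card_image_iff] at hkey
  exact hne (hkey (by simpa using ha) (by simpa using ha) (by simp))

end Counting

section Dihedral

variable {G : Type*} [Group G] [Finite G]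

/-- The homomorphism from the dihedral group onto `{1, -1}` with the rotations as kernel. -/
def dihedralSign (m : ℕ) : DihedralGroup m →* ℤˣ where
  toFun
    | .r _ => 1
    | .sr _ => -1
  map_one' := rfl
  map_mul' := by
    rintro (i | i) (j | j) <;> simp

theorem permDefect_zpowers_ne_zero {m : ℕ} (hm : 3 ≤ m) (φ : G →* DihedralGroup m)
    (hφ : Function.Surjective φ) {g : G} {i : ZMod m} (hg : φ g = .sr i) :
    permDefect (Subgroup.zpowers g) ≠ 0 := by
  classical
  obtain ⟨h, hh⟩ := hφ (.sr (i + 1))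
  rw [permDefect, Finset.card_ne_zero]
  refine ⟨Subgroup.zpowers h, Finset.mem_filter.2
    ⟨mem_cyclicFinset_iff.2 ⟨h, Subgroup.mem_top h, rfl⟩, fun heq => ?_⟩⟩
  have hmem : h * g ∈ (Subgroup.zpowers g : Set G) * (Subgroup.zpowers h : Set G) :=
    heq ▸ Set.mul_mem_mul (Subgroup.mem_zpowers h) (Subgroup.mem_zpowers g)
  obtain ⟨u, ⟨a, rfl⟩, v, ⟨b, rfl⟩, hab⟩ := Set.mem_mul.1 hmem
  have hpow (j : ZMod m) (k : ℤ) : (DihedralGroup.sr j) ^ k = 1 ∨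
      (DihedralGroup.sr j) ^ k = DihedralGroup.sr j := by
    have h2 : (DihedralGroup.sr j) ^ (2 : ℤ) = 1 := by
      rw [zpow_ofNat, pow_two, DihedralGroup.sr_mul_self]
    rcases Int.even_or_odd' k with ⟨l, rfl | rfl⟩
    · left; rw [zpow_mul, h2, one_zpow]
    · right; rw [zpow_add, zpow_mul, h2, one_zpow, one_mul, zpow_one]
  have := Fact.mk (show 1 < m by omega)
  have h2 : (2 : ZMod m) ≠ 0 := by
    intro h
    have : m ∣ 2 := (ZMod.natCast_eq_zero_iff 2 m).1 (by exact_mod_cast h)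
    exact absurd (Nat.le_of_dvd (by norm_num) this) (by omega)
  have himg := congrArg φ hab
  simp only [map_mul, map_zpow, hg, hh] at himg
  rcases hpow i a with h1 | h1 <;> rcases hpow (i + 1) b with h3 | h3 <;>
    simp only [h1, h3, DihedralGroup.sr_mul_sr, DihedralGroup.one_def, DihedralGroup.r_mul_r,
      DihedralGroup.r_mul_sr, DihedralGroup.sr_mul_r, DihedralGroup.r.injEq,
      reduceCtorEq] at himg
  · exact one_ne_zero (α := ZMod m) (by linear_combination himg)
  · exact h2 (by linear_combination himg)

theorem numRelCsd_ne_two_of_dihedral_quotient {K : Type*} [Group K] (e : G ≃* K) {m : ℕ}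
    (hm : 3 ≤ m) (φ : K →* DihedralGroup m) (hφ : Function.Surjective φ)
    (hnormal : ∀ a i, φ a = .r i → ∀ g, g * a * g⁻¹ ∈ Subgroup.zpowers a)
    (hfour : ∀ g i, φ g = .sr i → g ^ 4 = 1) : numRelCsd G ≠ 2 := by
  set ψ : G →* DihedralGroup m := φ.comp e.toMonoidHom with hψ
  have hψs : Function.Surjective ψ := hφ.comp e.surjective
  have hin {g : G} (hg : g ∈ ((dihedralSign m).comp ψ).ker) : ∃ i, ψ g = .r i := by
    rw [MonoidHom.mem_ker, MonoidHom.comp_apply] at hg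
    generalize ψ g = x at hg
    rcases x with i | i
    · exact ⟨i, rfl⟩
    · exact absurd (show (-1 : ℤˣ) = 1 from hg) (by decide)
  have hout {g : G} (hg : g ∉ ((dihedralSign m).comp ψ).ker) : ∃ i, ψ g = .sr i := by
    rw [MonoidHom.mem_ker, MonoidHom.comp_apply] at hg
    generalize ψ g = x at hg
    rcases x with i | i
    · exact absurd rfl hg
    · exact ⟨i, rfl⟩
  refine numRelCsd_ne_two_of_index_two ((dihedralSign m).comp ψ).ker ?_ ?_ ?_ ?_ ?_
  · have hs : Function.Surjective ((dihedralSign m).comp ψ) := by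
      intro u
      rcases Int.units_eq_one_or u with rfl | rfl
      · exact ⟨1, map_one _⟩
      · obtain ⟨g, hg⟩ := hψs (.sr 0)
        exact ⟨g, by rw [MonoidHom.comp_apply, hg]; rfl⟩
    rw [Subgroup.index_ker, MonoidHom.range_eq_top.2 hs, Subgroup.card_top]
    simp
  · intro a ha
    obtain ⟨i, hi⟩ := hin ha
    refine ⟨fun x hx g => ?_⟩
    obtain ⟨k, rfl⟩ := Subgroup.mem_zpowers_iff.1 hx
    obtain ⟨l, hl⟩ := Subgroup.mem_zpowers_iff.1 (hnormal (e a) i hi (e g))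
    have : a ^ l = g * a * g⁻¹ := e.injective (by simpa using hl)
    rw [← conj_zpow, ← this]
    exact Subgroup.zpow_mem _ (Subgroup.zpow_mem _ (Subgroup.mem_zpowers a) _) _
  · intro g hg
    obtain ⟨i, hi⟩ := hout hg
    exact e.injective (by simpa using hfour (e g) i hi)
  · intro g hg
    obtain ⟨i, hi⟩ := hout hg
    exact permDefect_zpowers_ne_zero hm ψ hψs hi
  · obtain ⟨a, ha⟩ := hψs (.r 1)
    refine ⟨a, by rw [MonoidHom.mem_ker, MonoidHom.comp_apply, ha]; rfl, fun h => ?_⟩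
    have h1 := congrArg ψ h
    rw [map_inv, ha, DihedralGroup.inv_r, DihedralGroup.r.injEq] at h1
    have : m ∣ 2 := (ZMod.natCast_eq_zero_iff 2 m).1 (by push_cast; linear_combination h1)
    exact absurd (Nat.le_of_dvd (by norm_num) this) (by omega)

theorem numRelCsd_ne_two_of_dihedral {m : ℕ} (hm : 3 ≤ m) (e : G ≃* DihedralGroup m) :
    numRelCsd G ≠ 2 := by
  refine numRelCsd_ne_two_of_dihedral_quotient e hm (MonoidHom.id _) Function.surjective_id ?_ ?_
  · rintro _ i rfl (j | j)
    · exact Subgroup.mem_zpowers_iff.2 ⟨1, by simp⟩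
    · exact Subgroup.mem_zpowers_iff.2 ⟨-1, by simp⟩
  · rintro _ i rfl
    rw [show 4 = 2 * 2 from rfl, pow_mul, pow_two (DihedralGroup.sr i), DihedralGroup.sr_mul_self,
      one_pow]

end Dihedral

section Quaternion

variable {G : Type*} [Group G] [Finite G]

theorem QuaternionGroup.conj_a_mem_zpowers {m : ℕ} (i : ZMod (2 * m)) (g : QuaternionGroup m) :
    g * a i * g⁻¹ ∈ Subgroup.zpowers (a i) := by
  rcases g with j | j
  · exact Subgroup.mem_zpowers_iff.2 ⟨1, by
      rw [zpow_one, eq_mul_inv_iff_mul_eq, a_mul_a, a_mul_a, add_comm]⟩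
  · refine Subgroup.mem_zpowers_iff.2 ⟨-1, ?_⟩
    rw [zpow_neg_one, eq_mul_inv_iff_mul_eq, inv_mul_eq_iff_eq_mul, xa_mul_a, a_mul_xa,
      add_sub_cancel_right]

/-- The quotient of the generalized quaternion group of order `4 * m` by its central involution. -/
def quaternionToDihedral (m : ℕ) : QuaternionGroup m →* DihedralGroup m where
  toFun
    | .a i => .r (ZMod.castHom (Dvd.intro_left 2 rfl) (ZMod m) i)
    | .xa i => .sr (ZMod.castHom (Dvd.intro_left 2 rfl) (ZMod m) i)
  map_one' := congrArg DihedralGroup.r (map_zero _)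
  map_mul' := by
    rintro (i | i) (j | j)
    · simp only [QuaternionGroup.a_mul_a, DihedralGroup.r_mul_r, map_add]
    · simp only [QuaternionGroup.a_mul_xa, DihedralGroup.r_mul_sr, map_sub]
    · simp only [QuaternionGroup.xa_mul_a, DihedralGroup.sr_mul_r, map_add]
    · simp only [QuaternionGroup.xa_mul_xa, DihedralGroup.sr_mul_sr, map_sub, map_add,
        map_natCast, CharP.cast_eq_zero, zero_add]

theorem numRelCsd_ne_two_of_quaternion {m : ℕ} (hm : 3 ≤ m) (e : G ≃* QuaternionGroup m) :
    numRelCsd G ≠ 2 := by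
  have hs : Function.Surjective
      (ZMod.castHom (Dvd.intro_left 2 rfl : m ∣ 2 * m) (ZMod m)) := ZMod.castHom_surjective _
  refine numRelCsd_ne_two_of_dihedral_quotient e hm (quaternionToDihedral m) ?_ ?_ ?_
  · rintro (i | i)
    · obtain ⟨j, rfl⟩ := hs i
      exact ⟨.a j, rfl⟩
    · obtain ⟨j, rfl⟩ := hs i
      exact ⟨.xa j, rfl⟩
  · rintro (j | j) i h g
    · exact QuaternionGroup.conj_a_mem_zpowers j g
    · exact absurd h (by simp [quaternionToDihedral])
  · rintro (j | j) i h
    · exact absurd h (by simp [quaternionToDihedral])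
    · have : NeZero m := ⟨by omega⟩
      rw [← QuaternionGroup.orderOf_xa j, pow_orderOf_eq_one]

theorem numRelCsd_quaternion_two (e : G ≃* QuaternionGroup 2) : numRelCsd G = 1 := by
  have hconj : ∀ a g : QuaternionGroup 2, g * a * g⁻¹ = a ∨ g * a * g⁻¹ = a⁻¹ := by decide
  refine numRelCsd_eq_one_of_normal fun a => ⟨fun x hx g => ?_⟩
  obtain ⟨k, rfl⟩ := Subgroup.mem_zpowers_iff.1 hx
  have h : g * a * g⁻¹ = a ∨ g * a * g⁻¹ = a⁻¹ :=
    (hconj (e a) (e g)).imp (fun h => e.injective (by simpa using h))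
      (fun h => e.injective (by simpa using h))
  rw [← conj_zpow]
  refine Subgroup.zpow_mem _ ?_ _
  rcases h with h | h <;> simp [h]

end Quaternion

section Quasidihedral

variable {G : Type*} [Group G] [Finite G]

namespace QuasidihedralGroup

/-- The generator of order `2 ^ (n - 1)`. -/
def x (n : ℕ) : QuasidihedralGroup n := PresentedGroup.of 0

/-- The non-central generating involution. -/
def y (n : ℕ) : QuasidihedralGroup n := PresentedGroup.of 1

theorem x_pow (n : ℕ) : x n ^ 2 ^ (n - 1) = 1 :=
  PresentedGroup.one_of_mem (rels := quasidihedralRels n)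
    (x := FreeGroup.of 0 ^ (2 ^ (n - 1))) (by simp [quasidihedralRels])

theorem y_sq (n : ℕ) : y n ^ 2 = 1 :=
  PresentedGroup.one_of_mem (rels := quasidihedralRels n)
    (x := FreeGroup.of 1 ^ 2) (by simp [quasidihedralRels])

theorem y_mul_y (n : ℕ) : y n * y n = 1 := by rw [← pow_two, y_sq]

theorem y_inv (n : ℕ) : (y n)⁻¹ = y n := inv_eq_of_mul_eq_one_left (y_mul_y n)

theorem conj_x (n : ℕ) : y n * x n * (y n)⁻¹ = x n ^ (2 ^ (n - 2) - 1) := by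
  have h : (y n)⁻¹ * x n * y n * (x n ^ (2 ^ (n - 2) - 1))⁻¹ = 1 :=
    PresentedGroup.one_of_mem (rels := quasidihedralRels n)
      (x := (FreeGroup.of 1)⁻¹ * FreeGroup.of 0 * FreeGroup.of 1 *
        (FreeGroup.of 0 ^ (2 ^ (n - 2) - 1))⁻¹) (by simp [quasidihedralRels])
  rw [mul_inv_eq_one] at h
  rw [← h, y_inv]

theorem y_mul_x_zpow (n : ℕ) (i : ℤ) :
    y n * x n ^ i = x n ^ (((2 ^ (n - 2) - 1 : ℕ) : ℤ) * i) * y n := by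
  rw [← mul_inv_eq_iff_eq_mul, ← conj_zpow, conj_x, zpow_mul, zpow_natCast]

theorem exists_eq (n : ℕ) (g : QuasidihedralGroup n) :
    ∃ i : ℤ, g = x n ^ i ∨ g = x n ^ i * y n := by
  have hg : g ∈ Subgroup.closure (Set.range (PresentedGroup.of (rels := quasidihedralRels n))) := by
    rw [PresentedGroup.closure_range_of]; trivial
  induction hg using Subgroup.closure_induction with
  | mem g hg =>
    obtain ⟨k, rfl⟩ := hg
    fin_cases k
    · exact ⟨1, Or.inl (zpow_one _).symm⟩
    · exact ⟨0, Or.inr (by rw [zpow_zero, one_mul]; rfl)⟩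
  | one => exact ⟨0, Or.inl (zpow_zero _).symm⟩
  | mul a b _ _ ha hb =>
    obtain ⟨i, rfl | rfl⟩ := ha <;> obtain ⟨j, rfl | rfl⟩ := hb
    · exact ⟨i + j, Or.inl (zpow_add _ _ _).symm⟩
    · exact ⟨i + j, Or.inr (by rw [zpow_add, mul_assoc])⟩
    · exact ⟨i + _, Or.inr (by rw [mul_assoc, y_mul_x_zpow, ← mul_assoc, ← zpow_add])⟩
    · exact ⟨i + _, Or.inl (by
        rw [mul_assoc, ← mul_assoc (y n), y_mul_x_zpow, mul_assoc _ (y n), y_mul_y, mul_one,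
          ← zpow_add])⟩
  | inv a _ ha =>
    obtain ⟨i, rfl | rfl⟩ := ha
    · exact ⟨-i, Or.inl (zpow_neg _ _).symm⟩
    · exact ⟨_, Or.inr (by rw [mul_inv_rev, y_inv, ← zpow_neg, y_mul_x_zpow])⟩

theorem conj_x_zpow_mem_zpowers (n : ℕ) (i : ℤ) (g : QuasidihedralGroup n) :
    g * x n ^ i * g⁻¹ ∈ Subgroup.zpowers (x n ^ i) := by
  obtain ⟨j, rfl | rfl⟩ := exists_eq n g
  · refine Subgroup.mem_zpowers_iff.2 ⟨1, ?_⟩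
    rw [zpow_one, eq_mul_inv_iff_mul_eq, ← zpow_add, ← zpow_add, add_comm]
  · refine Subgroup.mem_zpowers_iff.2 ⟨((2 ^ (n - 2) - 1 : ℕ) : ℤ), ?_⟩
    rw [eq_mul_inv_iff_mul_eq, mul_assoc _ (y n), y_mul_x_zpow, ← zpow_mul, ← mul_assoc,
      ← mul_assoc, ← zpow_add, ← zpow_add]
    congr 2
    ring

theorem x_zpow_mul_y_pow_four {n : ℕ} (hn : 2 ≤ n) (i : ℤ) : (x n ^ i * y n) ^ 4 = 1 := by
  have hsq : (x n ^ i * y n) ^ 2 = x n ^ (2 ^ (n - 2) * i) := by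
    rw [pow_two, mul_assoc, ← mul_assoc (y n), y_mul_x_zpow, mul_assoc _ (y n), y_mul_y, mul_one,
      ← zpow_add, Nat.cast_sub Nat.one_le_two_pow]
    congr 1
    push_cast
    ring
  rw [show 4 = 2 * 2 from rfl, pow_mul, hsq, ← zpow_natCast, ← zpow_mul,
    show (2 : ℤ) ^ (n - 2) * i * ((2 : ℕ) : ℤ) = ((2 ^ (n - 1) : ℕ) : ℤ) * i by
      rw [show n - 1 = n - 2 + 1 by omega]; push_cast; ring,
    zpow_mul, zpow_natCast, x_pow, one_zpow]

/-- The quotient of the quasidihedral group by its center. -/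
def toDihedral {n : ℕ} (hn : 2 ≤ n) : QuasidihedralGroup n →* DihedralGroup (2 ^ (n - 2)) :=
  PresentedGroup.toGroup (f := ![.r 1, .sr 0]) (by
    have hr : (DihedralGroup.r 1 : DihedralGroup (2 ^ (n - 2))) ^ 2 ^ (n - 2) = 1 :=
      DihedralGroup.r_one_pow_n
    rintro r (rfl | rfl | rfl)
    · rw [show n - 1 = n - 2 + 1 by omega, pow_succ (2 : ℕ)]
      simp [pow_mul, hr]
    · simp [pow_two]
    · have h : (DihedralGroup.r 1 : DihedralGroup (2 ^ (n - 2))) ^ (2 ^ (n - 2) - 1) = .r (-1) := by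
        rw [← DihedralGroup.inv_r]
        refine eq_inv_of_mul_eq_one_left ?_
        rw [← pow_succ, Nat.sub_add_cancel Nat.one_le_two_pow, hr]
      simp [h])

theorem toDihedral_x_zpow {n : ℕ} (hn : 2 ≤ n) (i : ℤ) : toDihedral hn (x n ^ i) = .r i := by
  rw [map_zpow]
  have : toDihedral hn (x n) = .r 1 := PresentedGroup.toGroup.of _
  rw [this, DihedralGroup.r_one_zpow]

theorem toDihedral_x_zpow_mul_y {n : ℕ} (hn : 2 ≤ n) (i : ℤ) :
    toDihedral hn (x n ^ i * y n) = .sr (-i) := by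
  have : toDihedral hn (y n) = .sr 0 := PresentedGroup.toGroup.of _
  rw [map_mul, toDihedral_x_zpow, this, DihedralGroup.r_mul_sr, zero_sub]

end QuasidihedralGroup

open QuasidihedralGroup in
theorem numRelCsd_ne_two_of_quasidihedral {n : ℕ} (hn : 4 ≤ n) (e : G ≃* QuasidihedralGroup n) :
    numRelCsd G ≠ 2 := by
  have hn2 : 2 ≤ n := by omega
  have hm : 2 ^ 2 ≤ 2 ^ (n - 2) := Nat.pow_le_pow_right (by norm_num) (by omega)
  refine numRelCsd_ne_two_of_dihedral_quotient e (by omega) (toDihedral hn2) ?_ ?_ ?_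
  · rintro (i | i)
    · obtain ⟨k, rfl⟩ := ZMod.intCast_surjective i
      exact ⟨_, toDihedral_x_zpow hn2 k⟩
    · obtain ⟨k, rfl⟩ := ZMod.intCast_surjective i
      exact ⟨_, (toDihedral_x_zpow_mul_y hn2 (-k)).trans (by simp)⟩
  · intro a i h g
    obtain ⟨k, rfl | rfl⟩ := exists_eq n a
    · exact conj_x_zpow_mem_zpowers n k g
    · rw [toDihedral_x_zpow_mul_y] at h
      cases h
  · intro a i h
    obtain ⟨k, rfl | rfl⟩ := exists_eq n a
    · rw [toDihedral_x_zpow] at h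
      cases h
    · exact x_zpow_mul_y_pow_four hn2 k

end Quasidihedral

/-- `DihedralGroup (2 ^ (n - 1))` and `QuaternionGroup (2 ^ (n - 2))` are the dihedral and the
generalized quaternion group of order `2 ^ n`. -/
theorem corollary3p2 (G : Type*) [Group G] [Finite G]
    (hG : (∃ n : ℕ, 3 ≤ n ∧ Nonempty (G ≃* DihedralGroup (2 ^ (n - 1)))) ∨
      (∃ n : ℕ, 3 ≤ n ∧ Nonempty (G ≃* QuaternionGroup (2 ^ (n - 2)))) ∨
      (∃ n : ℕ, 4 ≤ n ∧ Nonempty (G ≃* QuasidihedralGroup n))) :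
    numRelCsd G ≠ 2 := by
  rcases hG with ⟨n, hn, ⟨e⟩⟩ | ⟨n, hn, ⟨e⟩⟩ | ⟨n, hn, ⟨e⟩⟩
  · have hm : 2 ^ 2 ≤ 2 ^ (n - 1) := Nat.pow_le_pow_right (by norm_num) (by omega)
    exact numRelCsd_ne_two_of_dihedral (by omega) e
  · obtain rfl | hn4 : n = 3 ∨ 4 ≤ n := by omega
    · rw [numRelCsd_quaternion_two e]
      norm_num
    · have hm : 2 ^ 2 ≤ 2 ^ (n - 2) := Nat.pow_le_pow_right (by norm_num) (by omega)
      exact numRelCsd_ne_two_of_quaternion (by omega) e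
  · exact numRelCsd_ne_two_of_quasidihedral hn e
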